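/- Let $\gamma,\gamma_0\in L^\infty(0,\pi)$ be real-valued with $\operatorname{ess\,inf}_{(0,\pi)}\gamma>0$, and let $\mathfrak L u=-(\gamma u')'+\gamma_0u$ with domain $\mathcal D(\mathfrak L)=\{u\in H^1_0(0,\pi):\ \mathfrak L u\in L^2(0,\pi)\}$, where $\mathfrak L u$ is understood in the sense of distributions and all functions are real-valued. Let $\Lambda$ be the set of eigenvalues of $\mathfrak L$, let $\lambda\in\Lambda$, let $\phi_\lambda\in\mathcal D(\mathfrak L)$ be an eigenfunction, $\mathfrak L\phi_\lambda=\lambda\phi_\lambda$ with $\|\phi_\lambda\|_{L^2(0,\pi)}=1$, and let $\tilde\phi_\lambda\in H^1(0,\pi)$ be a solution of $-(\gamma\tilde\phi_\lambda')'+\gamma_0\tilde\phi_\lambda=\lambda\tilde\phi_\lambda$ on $(0,\pi)$ (no boundary condition) that is linearly independent of $\phi_\lambda$. Let $F\in L^2(0,\pi)$ and let $\omega$ be a nonempty open subset of $(0,\pi)$. Let $\mathcal C$ be the set of connected components of $\overline{(0,\pi)\setminus\omega}$. For $C\in\mathcal C$ put $$M_\lambda(F,C)=\begin{pmatrix}\int_C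 F\phi_\lambda\\ 0\end{pmatrix}\ \text{if } C\cap\{0,\pi\}\neq\emptyset,\qquad M_\lambda(F,C)=\begin{pmatrix}\int_C F\phi_\lambda\\ \int_C F\tilde\phi_\lambda\end{pmatrix}\ \text{if } C\cap\{0,\pi\}=\emptyset,$$ and $\mathcal M_\lambda(F,\omega)=(M_\lambda(F,C))_{C\in\mathcal C}\in(\mathbb R^2)^{\mathcal C}$. Consider the two assertions (i) there is $u\in\mathcal D(\mathfrak L)$ with $\mathfrak L u-\lambda u=F$ in $(0,\pi)$ and $u=0$ a.e. in $\omega$; (ii) $F=0$ a.e. in $\omega$ and $\mathcal M_\lambda(F,\omega)=0$. Then (i) implies (ii). If moreover the union of those connected components of $\overline{(0,\pi)\setminus\omega}$ that consist of a single point has Lebesgue measure zero (for instance, if $\overline{(0,\pi)\setminus\omega}$ has at most countably many connected components), then (i) and (ii) are equivalent. -/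

import Mathlib

open MeasureTheory Set
open scoped Distributions

noncomputable section

namespace SturmLiouville

/-- The interval `(0, π)` as an open set. -/
def Om : TopologicalSpace.Opens ℝ := ⟨Ioo 0 Real.pi, isOpen_Ioo⟩

/-- Lebesgue measure on `(0, π)`. -/
def mu : Measure ℝ := volume.restrict (Ioo 0 Real.pi)

/-- `g` is the weak derivative of `u` on `(0, π)`, tested against `C_c^∞(0, π)`.
It is only used for `u, g` in `L²(0, π)`. -/
def HasWeakDeriv (u g : ℝ → ℝ) : Prop :=
  ∀ ζ : 𝓓(Om, ℝ), ∫ x, u x * deriv ζ x ∂mu = -∫ x, g x * ζ x ∂mu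

/-- `u ∈ H¹(0, π)`. -/
def MemH1 (u : ℝ → ℝ) : Prop :=
  MemLp u 2 mu ∧ ∃ g : ℝ → ℝ, MemLp g 2 mu ∧ HasWeakDeriv u g

/-- `u ∈ H¹₀(0, π)`: `u` lies in the closure of `C_c^∞(0, π)` in `H¹(0, π)`. -/
def MemH10 (u : ℝ → ℝ) : Prop :=
  MemLp u 2 mu ∧ ∃ g : ℝ → ℝ, MemLp g 2 mu ∧ HasWeakDeriv u g ∧
    ∀ ε : ENNReal, 0 < ε → ∃ ζ : 𝓓(Om, ℝ),
      eLpNorm (fun x => u x - ζ x) 2 mu ≤ ε ∧ eLpNorm (fun x => g x - deriv ζ x) 2 mu ≤ ε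

/-- For `u ∈ H¹(0, π)`: the identity `-(γ u')' + γ₀ u = f` in the sense of distributions on
`(0, π)`. -/
def HasL (γ γ₀ u f : ℝ → ℝ) : Prop :=
  ∃ g : ℝ → ℝ, MemLp g 2 mu ∧ HasWeakDeriv u g ∧
    HasWeakDeriv (fun x => γ x * g x) (fun x => γ₀ x * u x - f x)

/-- The domain `D(𝔏) = {u ∈ H¹₀(0, π) : 𝔏 u ∈ L²(0, π)}`. -/
def domL (γ γ₀ : ℝ → ℝ) : Set (ℝ → ℝ) :=
  {u | MemH10 u ∧ ∃ f : ℝ → ℝ, MemLp f 2 mu ∧ HasL γ γ₀ u f}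

/-- `φ ∈ D(𝔏)` and `𝔏 φ = lam φ`, with `‖φ‖_{L²(0, π)} = 1`. -/
def IsNormalizedEigenfunction (γ γ₀ : ℝ → ℝ) (lam : ℝ) (φ : ℝ → ℝ) : Prop :=
  φ ∈ domL γ γ₀ ∧ HasL γ γ₀ φ (fun x => lam * φ x) ∧ ∫ x, φ x ^ 2 ∂mu = 1

/-- The set `Λ` of eigenvalues of `𝔏`. -/
def eigenvalues (γ γ₀ : ℝ → ℝ) : Set ℝ :=
  {lam | ∃ φ ∈ domL γ γ₀, HasL γ γ₀ φ (fun x => lam * φ x) ∧ ¬ φ =ᵐ[mu] 0}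

/-- `ψ` is a solution in `H¹(0, π)` (without boundary conditions) of `-(γ ψ')' + γ₀ ψ = lam ψ`,
linearly independent of `φ`. -/
def IsSecondSolution (γ γ₀ : ℝ → ℝ) (lam : ℝ) (φ ψ : ℝ → ℝ) : Prop :=
  MemH1 ψ ∧ HasL γ γ₀ ψ (fun x => lam * ψ x) ∧
    ∀ a b : ℝ, (∀ᵐ x ∂mu, a * φ x + b * ψ x = 0) → a = 0 ∧ b = 0

/-- The closure of `(0, π) \ ω`. -/
def complClosure (ω : Set ℝ) : Set ℝ := closure (Ioo 0 Real.pi \ ω)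

/-- The set of connected components of the closure of `(0, π) \ ω`. -/
def components (ω : Set ℝ) : Set (Set ℝ) :=
  {C | ∃ x ∈ complClosure ω, C = connectedComponentIn (complClosure ω) x}

open Classical in
/-- The vector `M_λ(f, C)` attached to `φ = φ_λ` and `ψ`, a second solution. -/
def momentVec (φ ψ f : ℝ → ℝ) (C : Set ℝ) : Fin 2 → ℝ :=
  if (C ∩ {0, Real.pi}).Nonempty then ![∫ x in C, f x * φ x, 0]
  else ![∫ x in C, f x * φ x, ∫ x in C, f x * ψ x]

/-- The family `𝓜_λ(f, ω)` of vectors of `ℝ²` indexed by the connected components. -/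
def momentFamily (φ ψ f : ℝ → ℝ) (ω : Set ℝ) : components ω → Fin 2 → ℝ :=
  fun C => momentVec φ ψ f C

/-- The set of points that form by themselves a connected component of the closure of
`(0, π) \ ω`. -/
def pointComponents (ω : Set ℝ) : Set ℝ := {x | {x} ∈ components ω}

end SturmLiouville

end

namespace SturmLiouville

/-! A solution `u` and its flux `γ u'` have absolutely continuous representatives `U` and `P`, so
the equation is a first order linear system for `(U, P)`. For `V` solving the homogeneous equation
with flux `Q`, Lagrange's identity reads `(P V - U Q)' = -F V`, so integrals of `F V` over intervals
are boundary terms.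

Necessity: if `u` vanishes on `ω`, then so do its derivative and its flux, and by the equation `F`.
By continuity `U = P = 0` on the closure of `ω`. A component is a compact interval `[a, b]` whose
endpoints are `0`, `π` or points of that closure. At the latter both boundary terms vanish because
`U = P = 0`; at `0` and `π` they vanish against `φ` because `U = φ = 0`, whereas `ψ` need not vanish
there. This is why only the first moment is required of components touching the boundary.

Sufficiency: the Wronskian `W` of `φ, ψ` is a nonzero constant, and variation of parameters gives `u
= W⁻¹ (ψ A - φ B) + k φ` with `A = ∫₀ˣ F φ`, `B = ∫₀ˣ F ψ`. For `x ∈ ω` no component straddles `x`,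
so the moment conditions give `A(x) = 0` and `B(x) = m`, where `m` is the integral of `F ψ` over the
component of `0`. With `k = W⁻¹ m`, `u` vanishes on `ω`, and `A(π) = 0` gives the boundary condition
at `π`. Summing over components requires countable additivity: at most countably many components are
nondegenerate, and the one-point ones are negligible by hypothesis
(`setIntegral_sUnion_components_eq_zero`, `integral_eq_component_zero`). -/

theorem ae_mu_iff {p : ℝ → Prop} :
    (∀ᵐ x ∂mu, p x) ↔ ∀ᵐ x, x ∈ Ioo 0 Real.pi → p x :=
  ae_restrict_iff' measurableSet_Ioo

theorem mu_eq_restrict_Ioc : mu = volume.restrict (Ioc 0 Real.pi) :=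
  Measure.restrict_congr_set Ioo_ae_eq_Ioc

theorem mu_eq_restrict_Icc : mu = volume.restrict (Icc 0 Real.pi) :=
  Measure.restrict_congr_set Ioo_ae_eq_Icc

instance : IsFiniteMeasure mu := by
  unfold mu; infer_instance

theorem integral_mu_eq (d : ℝ → ℝ) : ∫ x, d x ∂mu = ∫ x in (0 : ℝ)..Real.pi, d x := by
  rw [mu_eq_restrict_Ioc, intervalIntegral.integral_of_le Real.pi_pos.le]

theorem integrable_mu_iff {d : ℝ → ℝ} :
    Integrable d mu ↔ IntervalIntegrable d volume 0 Real.pi := by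
  rw [mu_eq_restrict_Ioc, intervalIntegrable_iff_integrableOn_Ioc_of_le Real.pi_pos.le]
  rfl

theorem uIcc_zero_pi : uIcc 0 Real.pi = Icc 0 Real.pi := uIcc_of_le Real.pi_pos.le

theorem intervalIntegrable_of_mu {d : ℝ → ℝ} (hd : Integrable d mu) {a b : ℝ}
    (ha : a ∈ Icc 0 Real.pi) (hb : b ∈ Icc 0 Real.pi) : IntervalIntegrable d volume a b := by
  refine (integrable_mu_iff.1 hd).mono_set ?_
  rw [uIcc_zero_pi]
  exact uIcc_subset_Icc ha hb

theorem zero_mem_Icc : (0 : ℝ) ∈ Icc 0 Real.pi := ⟨le_rfl, Real.pi_pos.le⟩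

theorem pi_mem_Icc : Real.pi ∈ Icc 0 Real.pi := ⟨Real.pi_pos.le, le_rfl⟩

/-! ### Absolutely continuous functions on `[0, π]` -/

/-- `v` is absolutely continuous on `[0, π]` with derivative `d` almost everywhere. -/
def IsPrim (v d : ℝ → ℝ) : Prop :=
  AbsolutelyContinuousOnInterval v 0 Real.pi ∧ ∀ᵐ x ∂mu, HasDerivAt v (d x) x

namespace IsPrim

variable {v d w e : ℝ → ℝ}

theorem continuousOn (h : IsPrim v d) : ContinuousOn v (Icc 0 Real.pi) := by
  simpa only [uIcc_zero_pi] using h.1.continuousOn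

theorem congr (h : IsPrim v d) (hde : d =ᵐ[mu] e) : IsPrim v e := by
  refine ⟨h.1, ?_⟩
  filter_upwards [h.2, hde] with x hx he
  rwa [← he]

theorem add (h : IsPrim v d) (h' : IsPrim w e) :
    IsPrim (fun x => v x + w x) (fun x => d x + e x) := by
  refine ⟨h.1.add h'.1, ?_⟩
  filter_upwards [h.2, h'.2] with x hx he using hx.add he

theorem sub (h : IsPrim v d) (h' : IsPrim w e) :
    IsPrim (fun x => v x - w x) (fun x => d x - e x) := by
  refine ⟨h.1.sub h'.1, ?_⟩
  filter_upwards [h.2, h'.2] with x hx he using hx.sub he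

theorem const_mul (h : IsPrim v d) (c : ℝ) :
    IsPrim (fun x => c * v x) (fun x => c * d x) := by
  refine ⟨h.1.const_mul c, ?_⟩
  filter_upwards [h.2] with x hx using hx.const_mul c

theorem mul (h : IsPrim v d) (h' : IsPrim w e) :
    IsPrim (fun x => v x * w x) (fun x => d x * w x + v x * e x) := by
  refine ⟨h.1.mul h'.1, ?_⟩
  filter_upwards [h.2, h'.2] with x hx he using hx.mul he

theorem deriv_ae_eq (h : IsPrim v d) : deriv v =ᵐ[mu] d := by
  filter_upwards [h.2] with x hx using hx.deriv

theorem integrable (h : IsPrim v d) : Integrable d mu :=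
  (integrable_mu_iff.2 h.1.intervalIntegrable_deriv).congr h.deriv_ae_eq

theorem integral_eq (h : IsPrim v d) {a b : ℝ} (ha : a ∈ Icc 0 Real.pi)
    (hb : b ∈ Icc 0 Real.pi) : ∫ t in a..b, d t = v b - v a := by
  have hs : uIcc a b ⊆ uIcc 0 Real.pi := by
    rw [uIcc_zero_pi]; exact uIcc_subset_Icc ha hb
  rw [← (h.1.mono hs).integral_deriv_eq_sub]
  refine intervalIntegral.integral_congr_ae ?_
  have h2 : ∀ᵐ x, x ∈ Ioc 0 Real.pi → deriv v x = d x := by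
    rw [← ae_restrict_iff' measurableSet_Ioc, ← mu_eq_restrict_Ioc]
    exact h.deriv_ae_eq
  filter_upwards [h2] with x hx hxab
  refine (hx ?_).symm
  rcases le_total a b with hab | hab
  · rw [uIoc_of_le hab] at hxab
    exact ⟨ha.1.trans_lt hxab.1, hxab.2.trans hb.2⟩
  · rw [uIoc_of_ge hab] at hxab
    exact ⟨hb.1.trans_lt hxab.1, hxab.2.trans ha.2⟩

theorem eq_add_integral (h : IsPrim v d) {x : ℝ} (hx : x ∈ Icc 0 Real.pi) :
    v x = v 0 + ∫ t in (0 : ℝ)..x, d t := by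
  rw [h.integral_eq zero_mem_Icc hx]; ring

theorem memLp (h : IsPrim v d) {p : ENNReal} : MemLp v p mu := by
  obtain ⟨C, hC⟩ := isCompact_Icc.exists_bound_of_continuousOn h.continuousOn
  refine MemLp.of_bound ?_ C ?_
  · rw [mu_eq_restrict_Icc]
    exact h.continuousOn.aestronglyMeasurable measurableSet_Icc
  · rw [mu_eq_restrict_Icc]
    exact (ae_restrict_iff' measurableSet_Icc).2 (Filter.Eventually.of_forall hC)

end IsPrim

theorem isPrim_integral {d : ℝ → ℝ} (hd : Integrable d mu) :
    IsPrim (fun x => ∫ t in (0 : ℝ)..x, d t) d := by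
  have hd' := integrable_mu_iff.1 hd
  refine ⟨hd'.absolutelyContinuousOnInterval_intervalIntegral (by simp), ?_⟩
  rw [ae_mu_iff]
  filter_upwards [hd'.ae_hasDerivAt_integral] with x hx hx'
  exact hx (by rw [uIcc_zero_pi]; exact Ioo_subset_Icc_self hx') 0 (by simp)

theorem isPrim_of_contDiff {f : ℝ → ℝ} (hf : ContDiff ℝ 1 f) : IsPrim f (deriv f) :=
  ⟨hf.contDiffOn.absolutelyContinuousOnInterval,
    Filter.Eventually.of_forall fun x => (hf.differentiable (by simp) x).hasDerivAt⟩

theorem isPrim_const (c : ℝ) : IsPrim (fun _ => c) (fun _ => 0) := by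
  simpa using isPrim_of_contDiff (f := fun _ => c) contDiff_const

theorem isPrim_test (ζ : 𝓓(Om, ℝ)) : IsPrim ζ (deriv ζ) :=
  isPrim_of_contDiff (ζ.contDiff.of_le (by exact_mod_cast le_top))

theorem test_zero (ζ : 𝓓(Om, ℝ)) : ζ 0 = 0 := by
  by_contra h
  exact lt_irrefl _ (ζ.tsupport_subset (subset_tsupport _ h)).1

theorem test_pi (ζ : 𝓓(Om, ℝ)) : ζ Real.pi = 0 := by
  by_contra h
  exact lt_irrefl _ (ζ.tsupport_subset (subset_tsupport _ h)).2

theorem eqOn_Icc_of_ae_eq {v w : ℝ → ℝ} (hv : ContinuousOn v (Icc 0 Real.pi))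
    (hw : ContinuousOn w (Icc 0 Real.pi)) (h : v =ᵐ[mu] w) : EqOn v w (Icc 0 Real.pi) := by
  refine Measure.eqOn_Icc_of_ae_eq volume Real.pi_pos.ne ?_ hv hw
  rwa [← mu_eq_restrict_Icc]

/-- Continuity turns a.e. vanishing on an open set into vanishing everywhere there, and then the
pointwise derivative is that of the zero function. -/
theorem IsPrim.eq_zero_of_ae {v d : ℝ → ℝ} (h : IsPrim v d) {ω : Set ℝ} (hω : IsOpen ω)
    (hωsub : ω ⊆ Ioo 0 Real.pi) (h0 : ∀ᵐ x ∂(volume.restrict ω), v x = 0) :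
    (∀ x ∈ ω, v x = 0) ∧ ∀ᵐ x ∂(volume.restrict ω), d x = 0 := by
  have h1 : EqOn v (fun _ => 0) ω :=
    Measure.eqOn_open_of_ae_eq h0 hω (h.continuousOn.mono (hωsub.trans Ioo_subset_Icc_self))
      continuousOn_const
  refine ⟨h1, ?_⟩
  rw [ae_restrict_iff' hω.measurableSet]
  filter_upwards [ae_mu_iff.1 h.2] with x hx hxω
  refine (hx (hωsub hxω)).unique ?_
  exact (hasDerivAt_const x (0 : ℝ)).congr_of_eventuallyEq
    (Filter.eventually_of_mem (hω.mem_nhds hxω) h1)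

/-! ### Weak derivatives and absolutely continuous representatives -/

theorem IsPrim.hasWeakDeriv {v d : ℝ → ℝ} (h : IsPrim v d) : HasWeakDeriv v d := by
  intro ζ
  have hp := h.mul (isPrim_test ζ)
  have h1 := hp.integral_eq zero_mem_Icc pi_mem_Icc
  rw [test_zero, test_pi, ← integral_mu_eq] at h1
  obtain ⟨C, hC⟩ := (ζ.hasCompactSupport).exists_bound_of_continuous ζ.continuous
  have hi : Integrable (fun x => d x * ζ x) mu :=
    h.integrable.mul_bdd ζ.continuous.aestronglyMeasurable (Filter.Eventually.of_forall hC)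
  have hi' : Integrable (fun x => v x * deriv ζ x) mu := by
    exact (hp.integrable.sub hi).congr (Filter.Eventually.of_forall fun x => by simp)
  rw [integral_add hi hi'] at h1
  linarith

theorem HasWeakDeriv.congr {u g u' g' : ℝ → ℝ} (h : HasWeakDeriv u g) (hu : u =ᵐ[mu] u')
    (hg : g =ᵐ[mu] g') : HasWeakDeriv u' g' := by
  intro ζ
  have h1 : ∫ x, u' x * deriv ζ x ∂mu = ∫ x, u x * deriv ζ x ∂mu :=
    integral_congr_ae (by filter_upwards [hu] with x hx; rw [hx])
  have h2 : ∫ x, g' x * ζ x ∂mu = ∫ x, g x * ζ x ∂mu :=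
    integral_congr_ae (by filter_upwards [hg] with x hx; rw [hx])
  rw [h1, h2, h ζ]

/-- A smooth function with compact support in `(0, π)` and integral zero is the derivative of a
test function. -/
theorem exists_test_deriv_eq {h : ℝ → ℝ} (hc : ContDiff ℝ (⊤ : ℕ∞) h) (hs : HasCompactSupport h)
    (hsub : tsupport h ⊆ Ioo 0 Real.pi) (h0 : ∫ x, h x ∂mu = 0) :
    ∃ ζ : 𝓓(Om, ℝ), deriv ζ = h := by
  obtain ⟨a, b, ha, hb, hab⟩ : ∃ a b, 0 < a ∧ b < Real.pi ∧ tsupport h ⊆ Icc a b := by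
    rcases (tsupport h).eq_empty_or_nonempty with he | hne
    · exact ⟨1, 2, one_pos, Real.pi_gt_three.trans' (by norm_num), by simp [he]⟩
    · have hcpt : IsCompact (tsupport h) := hs
      exact ⟨sInf (tsupport h), sSup (tsupport h), (hsub (hcpt.sInf_mem hne)).1,
        (hsub (hcpt.sSup_mem hne)).2,
        subset_Icc_csInf_csSup hcpt.bddBelow hcpt.bddAbove⟩
  have hz : ∀ x, x ∉ Icc a b → h x = 0 := fun x hx => image_eq_zero_of_notMem_tsupport (hx ∘ @hab x)
  have hder : ∀ x, HasDerivAt (fun y => ∫ t in (0 : ℝ)..y, h t) (h x) x := fun x =>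
    intervalIntegral.integral_hasDerivAt_right (hc.continuous.intervalIntegrable _ _)
      (hc.continuous.stronglyMeasurableAtFilter _ _) hc.continuous.continuousAt
  have hd : deriv (fun y => ∫ t in (0 : ℝ)..y, h t) = h := funext fun x => (hder x).deriv
  have hsupp : Function.support (fun y => ∫ t in (0 : ℝ)..y, h t) ⊆ Icc a b := by
    intro y hy
    by_contra hn
    apply hy
    rw [mem_Icc, not_and_or, not_le, not_le] at hn
    rcases hn with hn | hn
    · refine (intervalIntegral.integral_congr (g := fun _ => 0) fun t ht => hz t fun ht' => ?_).trans
        (by simp)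
      have : t ≤ max 0 y := ht.2
      exact absurd (ht'.1.trans this) (not_le.2 (max_lt ha hn))
    -- To the right of `b` the integral up to `y` equals the full integral, which is zero, since `h`
    -- vanishes between `π` and `y`.
    · rw [integral_mu_eq] at h0
      show ∫ t in (0 : ℝ)..y, h t = 0
      rw [← intervalIntegral.integral_add_adjacent_intervals
        (hc.continuous.intervalIntegrable 0 Real.pi) (hc.continuous.intervalIntegrable _ y), h0,
        zero_add]
      refine (intervalIntegral.integral_congr (g := fun _ => 0) fun t ht => hz t fun ht' => ?_).trans
        (by simp)
      have : min Real.pi y ≤ t := ht.1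
      exact absurd (this.trans ht'.2) (not_le.2 (lt_min hb hn))
  have hts : tsupport (fun y => ∫ t in (0 : ℝ)..y, h t) ⊆ Icc a b :=
    closure_minimal hsupp isClosed_Icc
  refine ⟨⟨fun y => ∫ t in (0 : ℝ)..y, h t, ?_, ?_, ?_⟩, hd⟩
  · rw [contDiff_infty_iff_deriv, hd]
    exact ⟨fun x => (hder x).differentiableAt, hc⟩
  · exact isCompact_Icc.of_isClosed_subset (isClosed_tsupport _) hts
  · exact hts.trans fun x hx => ⟨ha.trans_le hx.1, hx.2.trans_lt hb⟩

theorem exists_bump : ∃ ρ : ℝ → ℝ, ContDiff ℝ (⊤ : ℕ∞) ρ ∧ HasCompactSupport ρ ∧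
    tsupport ρ ⊆ Ioo 0 Real.pi ∧ ∫ x, ρ x ∂mu = 1 := by
  let B : ContDiffBump (1 : ℝ) := ⟨1 / 4, 1 / 2, by norm_num, by norm_num⟩
  have hts : tsupport (B.normed volume) ⊆ Ioo 0 Real.pi := by
    rw [B.tsupport_normed_eq]
    intro x hx
    rw [Metric.mem_closedBall, Real.dist_eq, abs_le] at hx
    have := Real.pi_gt_three
    have h2 : B.rOut = 1 / 2 := rfl
    rw [h2] at hx
    constructor <;> linarith [hx.1, hx.2]
  refine ⟨B.normed volume, B.contDiff_normed, B.hasCompactSupport_normed, hts, ?_⟩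
  rw [mu, setIntegral_eq_integral_of_forall_compl_eq_zero, B.integral_normed]
  exact fun x hx => image_eq_zero_of_notMem_tsupport (hx ∘ @hts x)

/-- The du Bois-Reymond lemma. -/
theorem ae_eq_const_of_integral_deriv {u : ℝ → ℝ} (hu : Integrable u mu)
    (h : ∀ ζ : 𝓓(Om, ℝ), ∫ x, u x * deriv ζ x ∂mu = 0) : ∃ c : ℝ, ∀ᵐ x ∂mu, u x = c := by
  obtain ⟨ρ, hρc, hρs, hρsub, hρ1⟩ := exists_bump
  have hint : ∀ {f : ℝ → ℝ}, Continuous f → HasCompactSupport f →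
      Integrable f mu ∧ Integrable (fun x => u x * f x) mu := by
    intro f hf hfs
    obtain ⟨C, hC⟩ := hfs.exists_bound_of_continuous hf
    exact ⟨(hf.integrable_of_hasCompactSupport hfs).restrict,
      hu.mul_bdd hf.aestronglyMeasurable (Filter.Eventually.of_forall hC)⟩
  set c := ∫ x, u x * ρ x ∂mu with hc
  refine ⟨c, ?_⟩
  rw [ae_mu_iff]
  have key := IsOpen.ae_eq_zero_of_integral_contDiff_smul_eq_zero (μ := volume)
    (isOpen_Ioo (a := 0) (b := Real.pi)) (f := fun x => u x - c)
    (IntegrableOn.locallyIntegrableOn (hu.sub (integrable_const c))) ?_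
  · filter_upwards [key] with x hx hx'
    exact sub_eq_zero.1 (hx hx')
  intro f hf hfs hfsub
  obtain ⟨hfi, hfui⟩ := hint hf.continuous hfs
  obtain ⟨hρi, hρui⟩ := hint hρc.continuous hρs
  -- Subtracting `m ρ` makes the mean of `f` zero, so that `f - m ρ` is the derivative of a test
  -- function.
  set m := ∫ x, f x ∂mu with hm
  have hsupp : tsupport (fun x => f x - m * ρ x) ⊆ tsupport f ∪ tsupport ρ :=
    (tsupport_sub f (fun x => m * ρ x)).trans
      (union_subset_union_right _ (tsupport_mul_subset_right (f := fun _ => m)))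
  obtain ⟨ζ, hζ⟩ := exists_test_deriv_eq (h := fun x => f x - m * ρ x)
    (hf.sub (contDiff_const.mul hρc)) (hfs.sub hρs.mul_left)
    (hsupp.trans (union_subset hfsub hρsub))
    (by rw [integral_sub hfi (hρi.const_mul m), integral_const_mul, hρ1, ← hm]; ring)
  have h1 := h ζ
  rw [hζ] at h1
  have e1 : ∀ x, u x * (f x - m * ρ x) = u x * f x - m * (u x * ρ x) := fun x => by ring
  simp_rw [e1] at h1
  rw [integral_sub hfui (hρui.const_mul m), integral_const_mul, ← hc] at h1
  have h2 : ∫ x, f x • (u x - c) = ∫ x, f x • (u x - c) ∂mu := by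
    rw [mu, setIntegral_eq_integral_of_forall_compl_eq_zero]
    intro x hx
    rw [image_eq_zero_of_notMem_tsupport (hx ∘ @hfsub x), zero_smul]
  have e2 : ∀ x, f x • (u x - c) = u x * f x - c * f x := fun x => by
    rw [smul_eq_mul]; ring
  rw [h2]
  simp_rw [e2]
  rw [integral_sub hfui (hfi.const_mul c), integral_const_mul, ← hm]
  linarith

/-- The difference of `u` and a primitive of `g` has zero weak derivative, hence is constant by du
Bois-Reymond. -/
theorem HasWeakDeriv.exists_isPrim {u g : ℝ → ℝ} (hu : Integrable u mu) (hg : Integrable g mu)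
    (h : HasWeakDeriv u g) : ∃ v, IsPrim v g ∧ u =ᵐ[mu] v := by
  have hp := isPrim_integral hg
  set p := fun x => ∫ t in (0 : ℝ)..x, g t
  have hpi : Integrable p mu := memLp_one_iff_integrable.1 hp.memLp
  obtain ⟨c, hc⟩ := ae_eq_const_of_integral_deriv (u := fun x => u x - p x) (hu.sub hpi) <| by
    intro ζ
    obtain ⟨C, hC⟩ := (ζ.hasCompactSupport.deriv).exists_bound_of_continuous
      (ζ.contDiff.continuous_deriv (by simp))
    have hb : ∀ {f : ℝ → ℝ}, Integrable f mu → Integrable (fun x => f x * deriv ζ x) mu :=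
      fun hf => hf.mul_bdd
        (ζ.contDiff.continuous_deriv (by simp)).aestronglyMeasurable
        (Filter.Eventually.of_forall hC)
    simp_rw [sub_mul]
    rw [integral_sub (hb hu) (hb hpi), h ζ, hp.hasWeakDeriv ζ, sub_self]
  refine ⟨fun x => c + p x, by simpa using (isPrim_const c).add hp, ?_⟩
  filter_upwards [hc] with x hx
  linarith

/-! ### Increment estimates and boundary values in `H¹₀(0, π)` -/

theorem IsPrim.abs_le_integral {v d b : ℝ → ℝ} (h : IsPrim v d) (hb : Integrable b mu)
    (hdb : ∀ᵐ x ∂mu, |d x| ≤ b x) {x y : ℝ} (hx : x ∈ Icc 0 Real.pi) (hy : y ∈ Icc 0 Real.pi)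
    (hxy : x ≤ y) : |v y - v x| ≤ ∫ t in x..y, b t := by
  rw [← h.integral_eq hx hy, ← Real.norm_eq_abs]
  refine intervalIntegral.norm_integral_le_of_norm_le hxy ?_ (intervalIntegrable_of_mu hb hx hy)
  rw [mu_eq_restrict_Ioc, ae_restrict_iff' measurableSet_Ioc] at hdb
  filter_upwards [hdb] with t ht hxt
  exact ht ⟨hx.1.trans_lt hxt.1, hxt.2.trans hy.2⟩

theorem IsPrim.abs_sub_le {w e : ℝ → ℝ} (h : IsPrim w e) {x y : ℝ} (hx : x ∈ Icc 0 Real.pi)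
    (hy : y ∈ Icc 0 Real.pi) : |w y - w x| ≤ ∫ t, |e t| ∂mu := by
  wlog hxy : x ≤ y generalizing x y
  · rw [abs_sub_comm]
    exact this hy hx (le_of_not_ge hxy)
  refine (h.abs_le_integral h.integrable.abs (Filter.Eventually.of_forall fun _ => le_rfl)
    hx hy hxy).trans ?_
  rw [integral_mu_eq]
  refine intervalIntegral.integral_mono_interval hx.1 hxy hy.2
    (Filter.Eventually.of_forall fun _ => abs_nonneg _) (integrable_mu_iff.1 h.integrable.abs)

theorem mu_univ : mu univ = ENNReal.ofReal Real.pi := by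
  simp [mu]

theorem mu_real_univ : mu.real univ = Real.pi := by
  rw [Measure.real, mu_univ, ENNReal.toReal_ofReal Real.pi_pos.le]

theorem exists_integral_abs_le : ∃ K : ℝ, 0 < K ∧ ∀ (f : ℝ → ℝ) (ε : ℝ), 0 ≤ ε → MemLp f 2 mu →
    eLpNorm f 2 mu ≤ ENNReal.ofReal ε → ∫ x, |f x| ∂mu ≤ K * ε := by
  refine ⟨Real.pi ^ (1 / 2 : ℝ), Real.rpow_pos_of_pos Real.pi_pos _, fun f ε hε hf hle => ?_⟩
  have h1 : eLpNorm f 1 mu ≤ ENNReal.ofReal (Real.pi ^ (1 / 2 : ℝ) * ε) := by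
    refine (eLpNorm_le_eLpNorm_mul_rpow_measure_univ (p := 1) (q := 2) (by norm_num) hf.1).trans ?_
    rw [mu_univ, ENNReal.ofReal_rpow_of_pos Real.pi_pos, mul_comm,
      ENNReal.ofReal_mul (Real.rpow_nonneg Real.pi_pos.le _)]
    refine mul_le_mul' (le_of_eq ?_) hle
    norm_num
  have h2 : ∫ x, |f x| ∂mu = (eLpNorm f 1 mu).toReal := by
    have := integral_norm_eq_lintegral_enorm hf.1
    simpa only [eLpNorm_one_eq_lintegral_enorm, Real.norm_eq_abs] using this
  rw [h2]
  exact ENNReal.toReal_le_of_le_ofReal (by positivity) h1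

theorem memLp_of_test (ζ : 𝓓(Om, ℝ)) : MemLp ζ 2 mu := (isPrim_test ζ).memLp

theorem memLp_deriv_test (ζ : 𝓓(Om, ℝ)) : MemLp (deriv ζ) 2 mu := by
  obtain ⟨C, hC⟩ := (ζ.hasCompactSupport.deriv).exists_bound_of_continuous
    (ζ.contDiff.continuous_deriv (by simp))
  exact MemLp.of_bound (ζ.contDiff.continuous_deriv (by simp)).aestronglyMeasurable C
    (Filter.Eventually.of_forall hC)

theorem integrable_of_memLp {f : ℝ → ℝ} (hf : MemLp f 2 mu) : Integrable f mu :=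
  hf.integrable (by norm_num)

/-- The continuous representative of an element of `H¹₀(0, π)` vanishes at the endpoints. -/
theorem MemH10.eq_zero {u U g : ℝ → ℝ} (h : MemH10 u) (hU : IsPrim U g) (huU : u =ᵐ[mu] U) :
    U 0 = 0 ∧ U Real.pi = 0 := by
  obtain ⟨hu, g', hg', hw, happ⟩ := h
  obtain ⟨v, hv, huv⟩ := hw.exists_isPrim (integrable_of_memLp hu) (integrable_of_memLp hg')
  have hUv : EqOn U v (Icc 0 Real.pi) :=
    eqOn_Icc_of_ae_eq hU.continuousOn hv.continuousOn (huU.symm.trans huv)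
  obtain ⟨K, hK, hKb⟩ := exists_integral_abs_le
  have key : ∀ y ∈ Icc 0 Real.pi, (∀ ζ : 𝓓(Om, ℝ), ζ y = 0) → v y = 0 := by
    intro y hy hζy
    have hb : ∀ ε : ℝ, 0 < ε → Real.pi * |v y| ≤ ε := by
      intro ε hε
      -- Since `ζ y = 0`, `|v y| ≤ |v x - ζ x| + ∫ |g' - ζ'|` for every `x`; integrating in `x`
      -- gives `π |v y| ≤ K δ + π K δ`, which is `ε` for this `δ`.
      set δ := ε / (K * (1 + Real.pi)) with hδ
      have hπ := Real.pi_pos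
      have hδ0 : 0 < δ := by positivity
      obtain ⟨ζ, hζ1, hζ2⟩ := happ (ENNReal.ofReal δ) (ENNReal.ofReal_pos.2 hδ0)
      have i1 := hKb _ δ hδ0.le (hu.sub (memLp_of_test ζ)) hζ1
      have i2 := hKb _ δ hδ0.le (hg'.sub (memLp_deriv_test ζ)) hζ2
      have hw := hv.sub (isPrim_test ζ)
      have hwi : Integrable (fun x => |v x - ζ x|) mu := (integrable_of_memLp hw.memLp).abs
      have i3 : ∫ x, |v x - ζ x| ∂mu = ∫ x, |(u - ⇑ζ) x| ∂mu :=
        integral_congr_ae (by filter_upwards [huv] with x hx; simp [hx])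
      have i4 : ∫ _, |v y| ∂mu ≤ ∫ x, |v x - ζ x| + ∫ t, |g' t - deriv ζ t| ∂mu ∂mu := by
        refine integral_mono_ae (integrable_const _) (hwi.add (integrable_const _)) ?_
        filter_upwards [ae_mu_iff.2 (Filter.Eventually.of_forall fun x hx => hx)] with x hx
        have := hw.abs_sub_le (Ioo_subset_Icc_self hx) hy
        rw [hζy, sub_zero] at this
        have t := abs_sub_abs_le_abs_sub (v y) (v x - ζ x)
        linarith
      rw [integral_add hwi (integrable_const _), integral_const, integral_const, mu_real_univ,
        smul_eq_mul, smul_eq_mul, i3] at i4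
      have i5 : Real.pi * ∫ t, |g' t - deriv ζ t| ∂mu ≤ Real.pi * (K * δ) :=
        mul_le_mul_of_nonneg_left i2 hπ.le
      have i6 : K * δ + Real.pi * (K * δ) = ε := by
        rw [hδ]; field_simp
      linarith
    have h0 : Real.pi * |v y| ≤ 0 := le_of_forall_pos_le_add fun ε hε => by
      simpa using hb ε hε
    exact abs_eq_zero.1 (le_antisymm (nonpos_of_mul_nonpos_right h0 Real.pi_pos) (abs_nonneg _))
  rw [hUv zero_mem_Icc, hUv pi_mem_Icc]
  exact ⟨key 0 zero_mem_Icc test_zero, key _ pi_mem_Icc test_pi⟩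

theorem test_differentiable (ζ : 𝓓(Om, ℝ)) (x : ℝ) : DifferentiableAt ℝ ζ x :=
  ζ.contDiff.differentiable (by simp) x

/-- Differentiation of test functions, with values in `L²(0, π)`. -/
noncomputable def derivLp : 𝓓(Om, ℝ) →ₗ[ℝ] Lp ℝ 2 mu where
  toFun ζ := (memLp_deriv_test ζ).toLp
  map_add' ζ η := by
    rw [← MemLp.toLp_add]
    congr 1
    ext x
    exact deriv_add (test_differentiable ζ x) (test_differentiable η x)
  map_smul' c ζ := by
    rw [RingHom.id_apply, ← MemLp.toLp_const_smul]
    congr 1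
    ext x
    exact deriv_const_smul c (test_differentiable ζ x)

/-- By du Bois-Reymond, the orthogonal complement in `L²` of the derivatives of test functions
consists of constants. A mean-zero `g` is orthogonal to these, so it lies in the closure of those
derivatives. -/
theorem exists_test_eLpNorm_sub_deriv_le {g : ℝ → ℝ} (hg : MemLp g 2 mu) (h0 : ∫ x, g x ∂mu = 0)
    {δ : ℝ} (hδ : 0 < δ) :
    ∃ ζ : 𝓓(Om, ℝ), eLpNorm (fun x => g x - deriv ζ x) 2 mu ≤ ENNReal.ofReal δ := by
  have hmem : hg.toLp ∈ (LinearMap.range derivLp).topologicalClosure := by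
    rw [← Submodule.orthogonal_orthogonal_eq_closure, Submodule.mem_orthogonal]
    intro w hw
    rw [Submodule.mem_orthogonal] at hw
    obtain ⟨c, hc⟩ := ae_eq_const_of_integral_deriv (u := w) (integrable_of_memLp (Lp.memLp w)) <| by
      intro ζ
      rw [← hw (derivLp ζ) ⟨ζ, rfl⟩, L2.inner_def]
      refine integral_congr_ae ?_
      filter_upwards [(memLp_deriv_test ζ).coeFn_toLp] with x hx
      simp only [derivLp, LinearMap.coe_mk, AddHom.coe_mk, hx]
      simp
    rw [L2.inner_def]
    have : ∀ᵐ x ∂mu, inner ℝ (w x) ((hg.toLp : Lp ℝ 2 mu) x) = c * g x := by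
      filter_upwards [hc, hg.coeFn_toLp] with x hx hx'
      rw [hx, hx']
      simp [mul_comm]
    rw [integral_congr_ae this, integral_const_mul, h0, mul_zero]
  rw [← SetLike.mem_coe, Submodule.topologicalClosure_coe, Metric.mem_closure_iff] at hmem
  obtain ⟨_, ⟨ζ, rfl⟩, hζ⟩ := hmem δ hδ
  refine ⟨ζ, ?_⟩
  have h1 : eLpNorm (fun x => g x - deriv ζ x) 2 mu = edist hg.toLp (derivLp ζ) :=
    (Lp.edist_toLp_toLp g (deriv ζ) hg (memLp_deriv_test ζ)).symm
  rw [h1, edist_dist]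
  exact ENNReal.ofReal_le_ofReal hζ.le

/-- The zero boundary values make the mean of `g` zero, so `g` is approximated by some `ζ'`; as `U`
and `ζ` agree at `0`, `U - ζ` is then uniformly small. -/
theorem IsPrim.memH10 {U g : ℝ → ℝ} (hU : IsPrim U g) (hg : MemLp g 2 mu) (h0 : U 0 = 0)
    (hπ : U Real.pi = 0) : MemH10 U := by
  refine ⟨hU.memLp, g, hg, hU.hasWeakDeriv, fun ε hε => ?_⟩
  -- The radius below is built from `ε.toReal`, which is `0` at `⊤`.
  wlog hεt : ε ≠ ⊤ generalizing ε
  · obtain ⟨ζ, h1, h2⟩ := this 1 one_pos ENNReal.one_ne_top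
    rw [ne_eq, not_not] at hεt
    exact ⟨ζ, by simp [hεt], by simp [hεt]⟩
  obtain ⟨K, hK, hKb⟩ := exists_integral_abs_le
  have hgi : ∫ x, g x ∂mu = 0 := by
    rw [integral_mu_eq, hU.integral_eq zero_mem_Icc pi_mem_Icc, h0, hπ, sub_zero]
  have hε' : 0 < ε.toReal := ENNReal.toReal_pos hε.ne' hεt
  set c : ℝ := Real.pi ^ (1 / 2 : ℝ) with hc
  have hcpos : 0 < c := Real.rpow_pos_of_pos Real.pi_pos _
  -- The first bound on `δ` serves the derivative. The second serves `U - ζ`, whose sup bound `K δ`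
  -- becomes the `L²` bound `c K δ`.
  obtain ⟨ζ, hζ⟩ := exists_test_eLpNorm_sub_deriv_le hg hgi
    (δ := min ε.toReal (ε.toReal / (K * c))) (by positivity)
  set δ := min ε.toReal (ε.toReal / (K * c)) with hδ
  have hδ0 : 0 < δ := by positivity
  refine ⟨ζ, ?_, hζ.trans (ENNReal.ofReal_le_of_le_toReal (min_le_left _ _))⟩
  have hb : ∀ᵐ x ∂mu, ‖U x - ζ x‖ ≤ K * δ := by
    filter_upwards [ae_mu_iff.2 (Filter.Eventually.of_forall fun x hx => hx)] with x hx
    have h1 := (hU.sub (isPrim_test ζ)).abs_sub_le zero_mem_Icc (Ioo_subset_Icc_self hx)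
    rw [h0, test_zero, sub_zero, sub_zero] at h1
    exact h1.trans (hKb _ δ hδ0.le (hg.sub (memLp_deriv_test ζ)) hζ)
  refine (eLpNorm_le_of_ae_bound hb).trans ?_
  rw [mu_univ, ENNReal.ofReal_rpow_of_pos Real.pi_pos,
    ← ENNReal.ofReal_mul (Real.rpow_nonneg Real.pi_pos.le _)]
  refine ENNReal.ofReal_le_of_le_toReal ?_
  have e1 : (ENNReal.toReal 2)⁻¹ = (1 / 2 : ℝ) := by norm_num
  rw [e1, ← hc]
  calc c * (K * δ) ≤ c * (K * (ε.toReal / (K * c))) := by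
        gcongr; exact min_le_right _ _
    _ = ε.toReal := by field_simp

/-! ### Solutions, Wronskians and variation of parameters -/

/-- `U` and `P = γ U'` are the absolutely continuous representatives attached to a solution of
`-(γ U')' + γ₀ U = f`. -/
def IsSol (γ γ₀ f U P : ℝ → ℝ) : Prop :=
  ∃ g : ℝ → ℝ, MemLp g 2 mu ∧ IsPrim U g ∧ (∀ᵐ x ∂mu, γ x * g x = P x) ∧
    IsPrim P (fun x => γ₀ x * U x - f x)

theorem IsSol.congr {γ γ₀ f f' U P : ℝ → ℝ} (h : IsSol γ γ₀ f U P) (hf : f =ᵐ[mu] f') :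
    IsSol γ γ₀ f' U P := by
  obtain ⟨g, hg, hU, hgP, hP⟩ := h
  refine ⟨g, hg, hU, hgP, hP.congr ?_⟩
  filter_upwards [hf] with x hx
  rw [hx]

theorem IsSol.hasL {γ γ₀ f U P : ℝ → ℝ} (h : IsSol γ γ₀ f U P) : HasL γ γ₀ U f := by
  obtain ⟨g, hg, hU, hgP, hP⟩ := h
  refine ⟨g, hg, hU.hasWeakDeriv, hP.hasWeakDeriv.congr ?_ Filter.EventuallyEq.rfl⟩
  filter_upwards [hgP] with x hx using hx.symm

theorem HasL.exists_isSol {γ γ₀ u f : ℝ → ℝ} (hγ : MemLp γ ⊤ mu) (hγ₀ : MemLp γ₀ ⊤ mu)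
    (hu : MemLp u 2 mu) (hf : MemLp f 2 mu) (h : HasL γ γ₀ u f) :
    ∃ U P, u =ᵐ[mu] U ∧ IsSol γ γ₀ f U P := by
  obtain ⟨g, hg, h1, h2⟩ := h
  obtain ⟨U, hU, huU⟩ := h1.exists_isPrim (integrable_of_memLp hu) (integrable_of_memLp hg)
  obtain ⟨P, hP, hgP⟩ := h2.exists_isPrim (integrable_of_memLp (hg.mul' hγ))
    (integrable_of_memLp ((hu.mul' hγ₀).sub hf))
  refine ⟨U, P, huU, g, hg, hU, hgP, hP.congr ?_⟩
  filter_upwards [huU] with x hx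
  rw [Pi.sub_apply, hx]

/-- Lagrange's identity. -/
theorem IsSol.wronskian {γ γ₀ f U P f' V Q : ℝ → ℝ} (h : IsSol γ γ₀ f U P)
    (h' : IsSol γ γ₀ f' V Q) :
    IsPrim (fun x => P x * V x - U x * Q x) (fun x => U x * f' x - f x * V x) := by
  obtain ⟨g, -, hU, hgP, hP⟩ := h
  obtain ⟨g', -, hV, hgQ, hQ⟩ := h'
  refine ((hP.mul hV).sub (hU.mul hQ)).congr ?_
  filter_upwards [hgP, hgQ] with x h1 h2
  rw [← h1, ← h2]
  ring

/-- Grönwall for the system `U' = P / γ`, `P' = (γ₀ - lam) U`: the continuous function `m = |U| +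
|P|` satisfies `m ≤ K ∫₀ˣ m`, so the integral `∫₀ˣ m`, whose right derivative is `m`, vanishes
identically. -/
theorem IsSol.eq_zero_of_initial {γ γ₀ U P : ℝ → ℝ} {lam : ℝ} (hγ₀ : MemLp γ₀ ⊤ mu)
    (hγpos : ∃ c : ℝ, 0 < c ∧ ∀ᵐ x ∂mu, c ≤ γ x)
    (h : IsSol γ γ₀ (fun x => lam * U x) U P) (hU0 : U 0 = 0) (hP0 : P 0 = 0) :
    ∀ x ∈ Icc 0 Real.pi, U x = 0 := by
  obtain ⟨c, hc, hcγ⟩ := hγpos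
  obtain ⟨g, -, hU, hgP, hP⟩ := h
  obtain ⟨C, hC0, hC⟩ : ∃ C, 0 ≤ C ∧ ∀ᵐ x ∂mu, |γ₀ x| ≤ C := by
    refine ⟨(eLpNormEssSup γ₀ mu).toReal, ENNReal.toReal_nonneg, ?_⟩
    have hfin : eLpNormEssSup γ₀ mu ≠ ⊤ := by simpa using hγ₀.2.ne
    filter_upwards [ae_le_eLpNormEssSup (f := γ₀) (μ := mu)] with x hx
    simpa using ENNReal.toReal_mono hfin hx
  have hmc : ContinuousOn (fun x => |U x| + |P x|) (Icc 0 Real.pi) :=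
    hU.continuousOn.abs.add hP.continuousOn.abs
  set m := fun x => |U x| + |P x| with hm
  have hmi : Integrable m mu := by
    rw [mu_eq_restrict_Icc]
    exact hmc.integrableOn_Icc
  set K := 1 / c + (C + |lam|) with hK
  have hb1 : ∀ᵐ x ∂mu, |g x| ≤ 1 / c * m x := by
    filter_upwards [hcγ, hgP] with x h1 h2
    rw [one_div_mul_eq_div, le_div_iff₀ hc]
    calc |g x| * c ≤ |g x| * γ x := by gcongr
      _ = |P x| := by rw [← h2, abs_mul, abs_of_pos (hc.trans_le h1), mul_comm]
      _ ≤ m x := le_add_of_nonneg_left (abs_nonneg _)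
  have hb2 : ∀ᵐ x ∂mu, |γ₀ x * U x - lam * U x| ≤ (C + |lam|) * m x := by
    filter_upwards [hC] with x h1
    rw [← sub_mul, abs_mul]
    refine mul_le_mul ((abs_sub _ _).trans (by gcongr)) (le_add_of_nonneg_right (abs_nonneg _))
      (abs_nonneg _) (by positivity)
  have hle : ∀ x ∈ Icc 0 Real.pi, m x ≤ K * ∫ t in (0 : ℝ)..x, m t := by
    intro x hx
    have i1 := hU.abs_le_integral (hmi.const_mul _) hb1 zero_mem_Icc hx hx.1
    have i2 := hP.abs_le_integral (hmi.const_mul _) hb2 zero_mem_Icc hx hx.1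
    rw [hU0, sub_zero, intervalIntegral.integral_const_mul] at i1
    rw [hP0, sub_zero, intervalIntegral.integral_const_mul] at i2
    calc m x ≤ _ := add_le_add i1 i2
      _ = _ := by rw [hK]; ring
  have hint0 : ∀ x ∈ Icc 0 Real.pi, 0 ≤ ∫ t in (0 : ℝ)..x, m t := fun x hx =>
    intervalIntegral.integral_nonneg hx.1 fun t _ => add_nonneg (abs_nonneg _) (abs_nonneg _)
  have hzero : ∀ x ∈ Icc 0 Real.pi, ∫ t in (0 : ℝ)..x, m t = 0 := by
    refine eq_zero_of_abs_deriv_le_mul_abs_self_of_eq_zero_right (f' := m) (K := K)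
      (isPrim_integral hmi).continuousOn (fun x hx => ?_) (by simp) fun x hx => ?_
    · have hx' : x ∈ Icc 0 Real.pi := ⟨hx.1, hx.2.le⟩
      refine intervalIntegral.integral_hasDerivWithinAt_right
        (intervalIntegrable_of_mu hmi zero_mem_Icc hx') (s := Ici x) (t := Ioi x) ?_ ?_
      · refine ⟨Ioc x Real.pi, Ioc_mem_nhdsGT hx.2, ?_⟩
        exact (hmc.mono fun t ht => ⟨hx.1.trans ht.1.le, ht.2⟩).aestronglyMeasurable
          measurableSet_Ioc
      · exact ((hmc x hx').mono_of_mem_nhdsWithin (by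
          refine Filter.mem_of_superset (Ioc_mem_nhdsGT hx.2) fun t ht => ⟨hx.1.trans ht.1.le, ht.2⟩))
    · have hx' : x ∈ Icc 0 Real.pi := ⟨hx.1, hx.2.le⟩
      rw [Real.norm_of_nonneg (hint0 x hx'), Real.norm_of_nonneg (by positivity)]
      exact hle x hx'
  intro x hx
  have := hle x hx
  rw [hzero x hx, mul_zero] at this
  have h1 := abs_nonneg (P x)
  exact abs_eq_zero.1 (le_antisymm (by simp only [hm] at this; linarith) (abs_nonneg _))

theorem IsSol.lin_comb {γ γ₀ U P V Q : ℝ → ℝ} {lam : ℝ}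
    (h : IsSol γ γ₀ (fun x => lam * U x) U P) (h' : IsSol γ γ₀ (fun x => lam * V x) V Q)
    (a b : ℝ) :
    IsSol γ γ₀ (fun x => lam * (a * U x + b * V x)) (fun x => a * U x + b * V x)
      (fun x => a * P x + b * Q x) := by
  obtain ⟨g, hg, hU, hgP, hP⟩ := h
  obtain ⟨g', hg', hV, hgQ, hQ⟩ := h'
  refine ⟨fun x => a * g x + b * g' x, (hg.const_mul a).add (hg'.const_mul b),
    (hU.const_mul a).add (hV.const_mul b), ?_, ((hP.const_mul a).add (hQ.const_mul b)).congr ?_⟩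
  · filter_upwards [hgP, hgQ] with x h1 h2
    rw [← h1, ← h2]; ring
  · exact Filter.Eventually.of_forall fun x => by ring

/-- Variation of parameters. -/
theorem IsSol.variation {γ γ₀ U P V Q F A B : ℝ → ℝ} {lam : ℝ}
    (h : IsSol γ γ₀ (fun x => lam * U x) U P) (h' : IsSol γ γ₀ (fun x => lam * V x) V Q)
    (hA : IsPrim A (fun x => F x * U x)) (hB : IsPrim B (fun x => F x * V x))
    {W : ℝ} (hW : W ≠ 0) (hWr : ∀ x ∈ Icc 0 Real.pi, P x * V x - U x * Q x = W) (k : ℝ) :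
    IsSol γ γ₀ (fun x => lam * (W⁻¹ * (V x * A x - U x * B x) + k * U x) + F x)
      (fun x => W⁻¹ * (V x * A x - U x * B x) + k * U x)
      (fun x => W⁻¹ * (Q x * A x - P x * B x) + k * P x) := by
  obtain ⟨g, hg, hU, hgP, hP⟩ := h
  obtain ⟨g', hg', hV, hgQ, hQ⟩ := h'
  refine ⟨fun x => W⁻¹ * (A x * g' x - B x * g x) + k * g x,
    (((hg'.mul' (hA.memLp (p := ⊤))).sub (hg.mul' (hB.memLp (p := ⊤)))).const_mul _).add (hg.const_mul k),
    ((((hV.mul hA).sub (hU.mul hB)).const_mul _).add (hU.const_mul k)).congr ?_, ?_,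
    ((((hQ.mul hA).sub (hP.mul hB)).const_mul _).add (hP.const_mul k)).congr ?_⟩
  · exact Filter.Eventually.of_forall fun x => by ring
  · filter_upwards [hgP, hgQ] with x h1 h2
    rw [← h1, ← h2]; ring
  · filter_upwards [ae_mu_iff.2 (Filter.Eventually.of_forall fun x hx => hx)] with x hx
    have h1 := hWr x (Ioo_subset_Icc_self hx)
    have h2 : W⁻¹ * (P x * V x - U x * Q x) = 1 := by rw [h1, inv_mul_cancel₀ hW]
    linear_combination (-F x) * h2

/-! ### Components of the closure of `(0, π) \ ω` -/

theorem complClosure_subset (ω : Set ℝ) : complClosure ω ⊆ Icc 0 Real.pi :=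
  closure_minimal (sdiff_subset.trans Ioo_subset_Icc_self) isClosed_Icc

theorem isCompact_complClosure (ω : Set ℝ) : IsCompact (complClosure ω) :=
  isCompact_Icc.of_isClosed_subset isClosed_closure (complClosure_subset ω)

theorem notMem_complClosure {ω : Set ℝ} (hω : IsOpen ω) {x : ℝ} (hx : x ∈ ω) :
    x ∉ complClosure ω := by
  intro h
  obtain ⟨y, hy, hy'⟩ := mem_closure_iff.1 h ω hω hx
  exact hy'.2 hy

theorem isClosed_connectedComponentIn_complClosure (ω : Set ℝ) (x : ℝ) :
    IsClosed (connectedComponentIn (complClosure ω) x) := by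
  by_cases hx : x ∈ complClosure ω
  · refine isClosed_of_closure_subset ?_
    refine isPreconnected_connectedComponentIn.closure.subset_connectedComponentIn
      (subset_closure (mem_connectedComponentIn hx)) ?_
    exact closure_minimal (connectedComponentIn_subset _ _) isClosed_closure
  · rw [connectedComponentIn_eq_empty hx]
    exact isClosed_empty

theorem connectedComponentIn_eq_Icc {ω : Set ℝ} {x : ℝ} (hx : x ∈ complClosure ω) :
    ∃ a b, a ∈ Icc 0 Real.pi ∧ b ∈ Icc 0 Real.pi ∧ a ≤ b ∧
      connectedComponentIn (complClosure ω) x = Icc a b := by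
  have hconn : IsConnected (connectedComponentIn (complClosure ω) x) :=
    isConnected_connectedComponentIn_iff.2 hx
  have hsub := connectedComponentIn_subset (complClosure ω) x
  have hcomp : IsCompact (connectedComponentIn (complClosure ω) x) :=
    (isCompact_complClosure ω).of_isClosed_subset
      (isClosed_connectedComponentIn_complClosure ω x) hsub
  have heq := eq_Icc_of_connected_compact hconn hcomp
  have hmem := hsub.trans (complClosure_subset ω)
  exact ⟨_, _, hmem (hcomp.sInf_mem hconn.nonempty), hmem (hcomp.sSup_mem hconn.nonempty),
    csInf_le_csSup hconn.nonempty hcomp.bddBelow hcomp.bddAbove, heq⟩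

theorem exists_Ioo_disjoint {ω : Set ℝ} {a : ℝ} (h : a ∉ closure ω) :
    ∃ ε > 0, ∀ y, |y - a| < ε → y ∉ ω := by
  rw [Metric.mem_closure_iff] at h
  push Not at h
  obtain ⟨ε, hε, h⟩ := h
  refine ⟨ε, hε, fun y hy hyω => ?_⟩
  have := h y hyω
  rw [dist_comm, Real.dist_eq] at this
  linarith

/-- The components are compact intervals whose endpoints lie in `{0, π}` or in the closure
of `ω`. -/
theorem exists_eq_Icc_of_mem_components {ω C : Set ℝ} (hC : C ∈ components ω) :
    ∃ a b, a ∈ Icc 0 Real.pi ∧ b ∈ Icc 0 Real.pi ∧ a ≤ b ∧ C = Icc a b ∧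
      (a = 0 ∨ a ∈ closure ω) ∧ (b = Real.pi ∨ b ∈ closure ω) := by
  obtain ⟨x, hx, rfl⟩ := hC
  obtain ⟨a, b, ha, hb, hab, heq⟩ := connectedComponentIn_eq_Icc hx
  have hsub := connectedComponentIn_subset (complClosure ω) x
  have hxm := mem_connectedComponentIn hx
  rw [heq] at hsub hxm
  -- Maximality of the component. An endpoint outside `{0, π}` and the closure of `ω` could be
  -- pushed outwards by a small `δ`, contradicting it.
  have hmax : ∀ a' b', a' ≤ a → b ≤ b' → Icc a' b' ⊆ complClosure ω → a' = a ∧ b' = b := by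
    intro a' b' haa hbb hs
    have h1 : Icc a' b' ⊆ Icc a b := by
      rw [← heq]
      exact isPreconnected_Icc.subset_connectedComponentIn ⟨haa.trans hxm.1, hxm.2.trans hbb⟩ hs
    rw [Icc_subset_Icc_iff (by linarith)] at h1
    exact ⟨le_antisymm haa h1.1, le_antisymm h1.2 hbb⟩
  refine ⟨a, b, ha, hb, hab, heq, ?_, ?_⟩
  · by_contra hcon
    rw [not_or] at hcon
    have ha0 : 0 < a := lt_of_le_of_ne ha.1 (Ne.symm hcon.1)
    obtain ⟨ε, hε, hdis⟩ := exists_Ioo_disjoint hcon.2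
    set δ := min ε a / 2 with hδ
    have hδ0 : 0 < δ := by positivity
    have hδε : δ < ε := by have := min_le_left ε a; linarith
    have hδa : δ < a := by have := min_le_right ε a; linarith
    have h2 := (hmax (a - δ) b (by linarith) le_rfl ?_).1
    · linarith
    · intro y hy
      rcases lt_or_ge y a with h | h
      · refine subset_closure ⟨⟨by linarith [hy.1], h.trans_le ha.2⟩, hdis y ?_⟩
        rw [abs_lt]; constructor <;> linarith [hy.1]
      · exact hsub ⟨h, hy.2⟩
  · by_contra hcon
    rw [not_or] at hcon
    have hbπ : 0 < Real.pi - b := sub_pos.2 (lt_of_le_of_ne hb.2 hcon.1)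
    obtain ⟨ε, hε, hdis⟩ := exists_Ioo_disjoint hcon.2
    set δ := min ε (Real.pi - b) / 2 with hδ
    have hδ0 : 0 < δ := by positivity
    have hδε : δ < ε := by have := min_le_left ε (Real.pi - b); linarith
    have hδa : δ < Real.pi - b := by have := min_le_right ε (Real.pi - b); linarith
    have h2 := (hmax a (b + δ) le_rfl (by linarith) ?_).2
    · linarith
    · intro y hy
      rcases lt_or_ge b y with h | h
      · refine subset_closure ⟨⟨hb.1.trans_lt h, by linarith [hy.2]⟩, hdis y ?_⟩
        rw [abs_lt]; constructor <;> linarith [hy.2]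
      · exact hsub ⟨hy.1, h⟩

theorem components_pairwiseDisjoint (ω : Set ℝ) : (components ω).PairwiseDisjoint id := by
  rintro _ ⟨x, hx, rfl⟩ _ ⟨y, hy, rfl⟩ hne
  rw [Function.onFun, id, id, disjoint_left]
  intro z hz hz'
  exact hne ((connectedComponentIn_eq hz).trans (connectedComponentIn_eq hz').symm)

theorem measurableSet_of_mem_components {ω C : Set ℝ} (hC : C ∈ components ω) :
    MeasurableSet C := by
  obtain ⟨a, b, -, -, -, rfl, -⟩ := exists_eq_Icc_of_mem_components hC
  exact measurableSet_Icc

theorem subset_complClosure_of_mem_components {ω C : Set ℝ} (hC : C ∈ components ω) :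
    C ⊆ complClosure ω := by
  obtain ⟨x, -, rfl⟩ := hC
  exact connectedComponentIn_subset _ _

/-- Components with nonempty interior are disjoint, hence countably many, so their integrals add up.
The others are single points, which together form a null set by `hnull`. -/
theorem setIntegral_sUnion_components_eq_zero {ω : Set ℝ}
    (hnull : volume (pointComponents ω) = 0) {S : Set (Set ℝ)} (hS : S ⊆ components ω)
    {h : ℝ → ℝ} (hh : Integrable h mu) (h0 : ∀ C ∈ S, ∫ x in C, h x = 0) :
    ∫ x in ⋃₀ S, h x = 0 := by
  set T := {C ∈ S | (interior C).Nonempty} with hT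
  have hTS : T ⊆ S := sep_subset _ _
  have hTc : T.Countable := PairwiseDisjoint.countable_of_nonempty_interior
    ((components_pairwiseDisjoint ω).subset (hTS.trans hS)) fun C hC => hC.2
  have hae : (⋃₀ S : Set ℝ) =ᵐ[volume] (⋃₀ T : Set ℝ) := by
    refine (ae_eq_set.2 ⟨measure_mono_null ?_ hnull, ?_⟩)
    · rintro x ⟨⟨C, hCS, hxC⟩, hxT⟩
      obtain ⟨a, b, -, -, hab, rfl, -⟩ := exists_eq_Icc_of_mem_components (hS hCS)
      have hab' : a = b := by
        by_contra hne
        refine hxT ⟨_, ⟨hCS, ?_⟩, hxC⟩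
        rw [interior_Icc]
        exact nonempty_Ioo.2 (lt_of_le_of_ne hab hne)
      subst hab'
      rw [Icc_self, mem_singleton_iff] at hxC
      subst hxC
      have := hS hCS
      rwa [Icc_self] at this
    · rw [sdiff_eq_empty.2 (sUnion_subset_sUnion hTS), measure_empty]
  rw [setIntegral_congr_set hae, sUnion_eq_iUnion]
  have : Countable T := hTc.to_subtype
  rw [integral_iUnion]
  · have : ∀ C : T, ∫ x in (C : Set ℝ), h x = 0 := fun C => h0 C (hTS C.2)
    simp [this]
  · exact fun C => measurableSet_of_mem_components (hS (hTS C.2))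
  · intro C D hne
    exact components_pairwiseDisjoint ω (hS (hTS C.2)) (hS (hTS D.2))
      fun h => hne (Subtype.ext h)
  · rw [mu_eq_restrict_Icc] at hh
    refine IntegrableOn.mono_set hh (iUnion_subset fun C => ?_)
    exact (subset_complClosure_of_mem_components (hS (hTS C.2))).trans (complClosure_subset ω)

theorem setIntegral_Icc_inter_complClosure {ω : Set ℝ} (hω : IsOpen ω) {h : ℝ → ℝ}
    (hz : ∀ᵐ x ∂(volume.restrict ω), h x = 0) {x : ℝ} (hx : x ∈ Icc 0 Real.pi) :
    ∫ t in (0 : ℝ)..x, h t = ∫ t in Icc 0 x ∩ complClosure ω, h t := by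
  rw [intervalIntegral.integral_of_le hx.1, integral_Ioc_eq_integral_Ioo]
  have h1 : (Icc 0 x ∩ complClosure ω : Set ℝ) =ᵐ[volume] (Ioo 0 x \ ω : Set ℝ) := by
    have h2 : (Icc 0 x ∩ complClosure ω : Set ℝ) =ᵐ[volume] (Ioo 0 x ∩ complClosure ω : Set ℝ) :=
      Ioo_ae_eq_Icc.symm.inter Filter.EventuallyEq.rfl
    refine h2.trans (Filter.EventuallyEq.of_eq ?_)
    ext y
    constructor
    · rintro ⟨hy, hyK⟩
      exact ⟨hy, fun hyω => notMem_complClosure hω hyω hyK⟩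
    · rintro ⟨hy, hyω⟩
      exact ⟨hy, subset_closure ⟨⟨hy.1, hy.2.trans_le hx.2⟩, hyω⟩⟩
  rw [setIntegral_congr_set h1]
  refine setIntegral_eq_of_subset_of_ae_sdiff_eq_zero measurableSet_Ioo.nullMeasurableSet
    sdiff_subset ?_
  rw [ae_restrict_iff' hω.measurableSet] at hz
  filter_upwards [hz] with y hy hy'
  refine hy ?_
  by_contra hn
  exact hy'.2 ⟨hy'.1, hn⟩

/-- A component meets `[0, x]` only if it is contained in it, for `x` outside of the components. -/
theorem subset_Icc_of_mem_components {ω C : Set ℝ} (hC : C ∈ components ω) {x y : ℝ}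
    (hxK : x ∉ complClosure ω) (hy : y ∈ C) (hyx : y ≤ x) : C ⊆ Icc 0 x := by
  have hsub := subset_complClosure_of_mem_components hC
  obtain ⟨a, b, ha, hb, hab, rfl, -⟩ := exists_eq_Icc_of_mem_components hC
  refine Icc_subset_Icc ha.1 ?_
  by_contra hn
  exact hxK (hsub ⟨hy.1.trans hyx, (not_le.1 hn).le⟩)

/-- A primitive of `h` takes one and the same value at all points of `ω`: a component meeting `[0,
x]` lies inside it, and all of them except that of `0` avoid both endpoints. If `0` is not in the
closure, the component on the right is empty and the value is `0`. -/
theorem integral_eq_component_zero {ω : Set ℝ} (hω : IsOpen ω)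
    (hnull : volume (pointComponents ω) = 0) {h : ℝ → ℝ} (hh : Integrable h mu)
    (hz : ∀ᵐ x ∂(volume.restrict ω), h x = 0) {x : ℝ} (hx : x ∈ ω) (hxI : x ∈ Ioo 0 Real.pi)
    (h0 : ∀ C ∈ components ω, ¬ (C ∩ {0, Real.pi}).Nonempty → ∫ t in C, h t = 0) :
    ∫ t in (0 : ℝ)..x, h t = ∫ t in connectedComponentIn (complClosure ω) 0, h t := by
  rw [setIntegral_Icc_inter_complClosure hω hz (Ioo_subset_Icc_self hxI)]
  set C₀ := connectedComponentIn (complClosure ω) 0 with hC₀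
  have hxK := notMem_complClosure hω hx
  set S := {C ∈ components ω | C ⊆ Icc 0 x ∧ 0 ∉ C} with hS
  have hSz := setIntegral_sUnion_components_eq_zero hnull (S := S) (sep_subset _ _) hh <| by
    rintro C ⟨hC, hCx, hC0⟩
    refine h0 C hC ?_
    rintro ⟨y, hyC, rfl | rfl⟩
    · exact hC0 hyC
    · exact absurd (hCx hyC).2 (not_le.2 hxI.2)
  have hC₀sub : C₀ ⊆ Icc 0 x ∩ complClosure ω := by
    intro y hy
    have h0K : (0 : ℝ) ∈ complClosure ω := by
      by_contra hn
      rw [hC₀, connectedComponentIn_eq_empty hn] at hy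
      exact hy
    exact ⟨subset_Icc_of_mem_components (C := C₀) ⟨0, h0K, rfl⟩ hxK
      (mem_connectedComponentIn h0K) hxI.1.le hy, connectedComponentIn_subset _ _ hy⟩
  have hun : Icc 0 x ∩ complClosure ω = ⋃₀ S ∪ C₀ := by
    apply Subset.antisymm
    · rintro y ⟨hy, hyK⟩
      by_cases h0y : (0 : ℝ) ∈ connectedComponentIn (complClosure ω) y
      · right
        rw [hC₀, ← connectedComponentIn_eq h0y]
        exact mem_connectedComponentIn hyK
      · left
        have hc : connectedComponentIn (complClosure ω) y ∈ components ω := ⟨y, hyK, rfl⟩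
        exact ⟨_, ⟨hc, subset_Icc_of_mem_components hc hxK (mem_connectedComponentIn hyK)
          hy.2, h0y⟩, mem_connectedComponentIn hyK⟩
    · rintro y (⟨C, ⟨hC, hCx, -⟩, hyC⟩ | hy)
      · exact ⟨hCx hyC, subset_complClosure_of_mem_components hC hyC⟩
      · exact hC₀sub hy
  have hmC₀ : MeasurableSet C₀ :=
    (isClosed_connectedComponentIn_complClosure ω 0).measurableSet
  have hdis : Disjoint (⋃₀ S) C₀ := by
    rw [disjoint_left]
    rintro y ⟨C, ⟨⟨z, hz, rfl⟩, -, hC0⟩, hyC⟩ hy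
    have h0K : (0 : ℝ) ∈ complClosure ω := by
      by_contra hn
      rw [hC₀, connectedComponentIn_eq_empty hn] at hy
      exact hy
    apply hC0
    rw [connectedComponentIn_eq hyC, ← connectedComponentIn_eq hy]
    exact mem_connectedComponentIn h0K
  rw [mu_eq_restrict_Icc] at hh
  have hsubI : ∀ {A : Set ℝ}, A ⊆ Icc 0 x ∩ complClosure ω → IntegrableOn h A := fun hA =>
    IntegrableOn.mono_set hh (hA.trans (inter_subset_right.trans (complClosure_subset ω)))
  rw [hun, setIntegral_union hdis hmC₀ (hsubI (hun ▸ subset_union_left)) (hsubI hC₀sub), hSz,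
    zero_add]

theorem integral_zero_pi_eq_zero {ω : Set ℝ} (hω : IsOpen ω)
    (hnull : volume (pointComponents ω) = 0) {h : ℝ → ℝ} (hh : Integrable h mu)
    (hz : ∀ᵐ x ∂(volume.restrict ω), h x = 0)
    (h0 : ∀ C ∈ components ω, ∫ t in C, h t = 0) :
    ∫ t in (0 : ℝ)..Real.pi, h t = 0 := by
  rw [setIntegral_Icc_inter_complClosure hω hz pi_mem_Icc,
    inter_eq_right.2 (complClosure_subset ω)]
  have hun : complClosure ω = ⋃₀ components ω :=
    Subset.antisymm (fun y hy => ⟨_, ⟨y, hy, rfl⟩, mem_connectedComponentIn hy⟩)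
      (sUnion_subset fun C hC => subset_complClosure_of_mem_components hC)
  rw [hun]
  exact setIntegral_sUnion_components_eq_zero hnull Subset.rfl hh h0

/-! ### Necessity of the moment conditions -/

theorem ae_restrict_of_ae_mu {ω : Set ℝ} (hω : ω ⊆ Icc 0 Real.pi) {p : ℝ → Prop}
    (h : ∀ᵐ x ∂mu, p x) : ∀ᵐ x ∂(volume.restrict ω), p x := by
  rw [mu_eq_restrict_Icc] at h
  exact ae_restrict_of_ae_restrict_of_subset hω h

theorem setIntegral_mul_congr {F v w : ℝ → ℝ} (h : v =ᵐ[mu] w) {C : Set ℝ}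
    (hC : C ⊆ Icc 0 Real.pi) : ∫ x in C, F x * v x = ∫ x in C, F x * w x :=
  integral_congr_ae (ae_restrict_of_ae_mu hC (by filter_upwards [h] with x hx; rw [hx]))

theorem exists_isSol_of_mem_domL {γ γ₀ u F : ℝ → ℝ} {lam : ℝ} (hγ : MemLp γ ⊤ mu)
    (hγ₀ : MemLp γ₀ ⊤ mu) (hF : MemLp F 2 mu) (hu : u ∈ domL γ γ₀)
    (h : HasL γ γ₀ u (fun x => lam * u x + F x)) :
    ∃ U P, u =ᵐ[mu] U ∧ IsSol γ γ₀ (fun x => lam * U x + F x) U P ∧ U 0 = 0 ∧ U Real.pi = 0 := by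
  have hu2 : MemLp u 2 mu := hu.1.1
  obtain ⟨U, P, huU, hsol⟩ := h.exists_isSol hγ hγ₀ hu2 ((hu2.const_mul lam).add hF)
  obtain ⟨g, -, hU, -⟩ := id hsol
  refine ⟨U, P, huU, hsol.congr ?_, hu.1.eq_zero hU huU⟩
  filter_upwards [huU] with x hx
  rw [Pi.add_apply, hx]

theorem eq_zero_of_mem_closure {v : ℝ → ℝ} (hv : ContinuousOn v (Icc 0 Real.pi)) {ω : Set ℝ}
    (hω : ω ⊆ Icc 0 Real.pi) (h0 : ∀ x ∈ ω, v x = 0) {a : ℝ} (ha : a ∈ closure ω) : v a = 0 := by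
  have hcl : IsClosed (Icc 0 Real.pi ∩ v ⁻¹' {0}) :=
    hv.preimage_isClosed_of_isClosed isClosed_Icc isClosed_singleton
  have hsub : ω ⊆ Icc 0 Real.pi ∩ v ⁻¹' {0} := fun x hx => ⟨hω hx, h0 x hx⟩
  exact (closure_minimal hsub hcl ha).2

theorem IsSol.vanish_on {γ γ₀ U P F : ℝ → ℝ} {lam : ℝ}
    (h : IsSol γ γ₀ (fun x => lam * U x + F x) U P) {ω : Set ℝ} (hω : IsOpen ω)
    (hωsub : ω ⊆ Ioo 0 Real.pi) (h0 : ∀ᵐ x ∂(volume.restrict ω), U x = 0) :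
    (∀ x ∈ closure ω, U x = 0 ∧ P x = 0) ∧ ∀ᵐ x ∂(volume.restrict ω), F x = 0 := by
  obtain ⟨g, -, hU, hgP, hP⟩ := h
  have hωI : ω ⊆ Icc 0 Real.pi := hωsub.trans Ioo_subset_Icc_self
  obtain ⟨hU0, hg0⟩ := hU.eq_zero_of_ae hω hωsub h0
  obtain ⟨hP0, hd0⟩ := hP.eq_zero_of_ae hω hωsub <| by
    filter_upwards [hg0, ae_restrict_of_ae_mu hωI hgP] with x h1 h2
    rw [← h2, h1, mul_zero]
  refine ⟨fun x hx => ⟨eq_zero_of_mem_closure hU.continuousOn hωI hU0 hx,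
    eq_zero_of_mem_closure hP.continuousOn hωI hP0 hx⟩, ?_⟩
  filter_upwards [h0, hd0] with x h1 h2
  rw [h1] at h2
  linarith

/-- Lagrange's identity on `[a, b]`: the boundary term `P V - U Q` vanishes at each end, because `U
= 0` there together with `P = 0` or `V = 0`. -/
theorem IsSol.setIntegral_eq_zero {γ γ₀ U P V Q F : ℝ → ℝ} {lam : ℝ}
    (h : IsSol γ γ₀ (fun x => lam * U x + F x) U P)
    (h' : IsSol γ γ₀ (fun x => lam * V x) V Q) {a b : ℝ} (ha : a ∈ Icc 0 Real.pi)
    (hb : b ∈ Icc 0 Real.pi) (hab : a ≤ b) (hUa : U a = 0) (hUb : U b = 0)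
    (hPa : P a = 0 ∨ V a = 0) (hPb : P b = 0 ∨ V b = 0) : ∫ x in Icc a b, F x * V x = 0 := by
  have h1 := (h.wronskian h').integral_eq ha hb
  have e : ∀ x, U x * (lam * V x) - (lam * U x + F x) * V x = -(F x * V x) := fun x => by ring
  simp_rw [e] at h1
  rw [hUa, hUb, mul_eq_zero.2 hPa, mul_eq_zero.2 hPb, intervalIntegral.integral_neg,
    intervalIntegral.integral_of_le hab, ← integral_Icc_eq_integral_Ioc] at h1
  linarith

theorem momentVec_eq_zero_iff {φ ψ F : ℝ → ℝ} {C : Set ℝ} :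
    momentVec φ ψ F C = 0 ↔ ∫ x in C, F x * φ x = 0 ∧
      (¬ (C ∩ {0, Real.pi}).Nonempty → ∫ x in C, F x * ψ x = 0) := by
  unfold momentVec
  split_ifs with h
  · simp [h]
  · simp [h]

theorem momentFamily_eq_zero_iff {φ ψ F : ℝ → ℝ} {ω : Set ℝ} :
    momentFamily φ ψ F ω = 0 ↔ ∀ C ∈ components ω, ∫ x in C, F x * φ x = 0 ∧
      (¬ (C ∩ {0, Real.pi}).Nonempty → ∫ x in C, F x * ψ x = 0) := by
  simp_rw [← momentVec_eq_zero_iff]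
  rw [funext_iff]
  exact Subtype.forall

theorem IsSol.moments {γ γ₀ U R Φ P Ψ Q F : ℝ → ℝ} {lam : ℝ}
    (h : IsSol γ γ₀ (fun x => lam * U x + F x) U R) (hU0 : U 0 = 0) (hUπ : U Real.pi = 0)
    (hΦ : IsSol γ γ₀ (fun x => lam * Φ x) Φ P) (hΦ0 : Φ 0 = 0) (hΦπ : Φ Real.pi = 0)
    (hΨ : IsSol γ γ₀ (fun x => lam * Ψ x) Ψ Q) {ω : Set ℝ}
    (hz : ∀ x ∈ closure ω, U x = 0 ∧ R x = 0) {C : Set ℝ} (hC : C ∈ components ω) :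
    ∫ x in C, F x * Φ x = 0 ∧
      (¬ (C ∩ {0, Real.pi}).Nonempty → ∫ x in C, F x * Ψ x = 0) := by
  obtain ⟨a, b, ha, hb, hab, rfl, ha', hb'⟩ := exists_eq_Icc_of_mem_components hC
  constructor
  · apply h.setIntegral_eq_zero hΦ ha hb hab
    · rcases ha' with rfl | ha'
      exacts [hU0, (hz a ha').1]
    · rcases hb' with rfl | hb'
      exacts [hUπ, (hz b hb').1]
    · rcases ha' with rfl | ha'
      exacts [Or.inr hΦ0, Or.inl (hz a ha').2]
    · rcases hb' with rfl | hb'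
      exacts [Or.inr hΦπ, Or.inl (hz b hb').2]
  · intro hne
    have ha'' := ha'.resolve_left fun e => hne ⟨a, left_mem_Icc.2 hab, Or.inl e⟩
    have hb'' := hb'.resolve_left fun e => hne ⟨b, right_mem_Icc.2 hab, Or.inr e⟩
    exact h.setIntegral_eq_zero hΨ ha hb hab (hz a ha'').1 (hz b hb'').1 (Or.inl (hz a ha'').2)
      (Or.inl (hz b hb'').2)

/-! ### Sufficiency of the moment conditions -/

/-- The Wronskian of two linearly independent solutions, the first of which vanishes at `0`, is
a nonzero constant. -/
theorem exists_wronskian_eq {γ γ₀ Φ P Ψ Q : ℝ → ℝ} {lam : ℝ} (hγ₀ : MemLp γ₀ ⊤ mu)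
    (hγpos : ∃ c : ℝ, 0 < c ∧ ∀ᵐ x ∂mu, c ≤ γ x)
    (hΦ : IsSol γ γ₀ (fun x => lam * Φ x) Φ P) (hΦ0 : Φ 0 = 0)
    (hΨ : IsSol γ γ₀ (fun x => lam * Ψ x) Ψ Q)
    (hind : ∀ a b : ℝ, (∀ᵐ x ∂mu, a * Φ x + b * Ψ x = 0) → a = 0 ∧ b = 0) :
    ∃ W : ℝ, W ≠ 0 ∧ ∀ x ∈ Icc 0 Real.pi, P x * Ψ x - Φ x * Q x = W := by
  refine ⟨P 0 * Ψ 0 - Φ 0 * Q 0, ?_, fun x hx => ?_⟩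
  · intro hW
    have hdep : ∀ a b : ℝ, a * Φ 0 + b * Ψ 0 = 0 → a * P 0 + b * Q 0 = 0 → a = 0 ∧ b = 0 := by
      intro a b h1 h2
      refine hind a b ?_
      have := (hΦ.lin_comb hΨ a b).eq_zero_of_initial hγ₀ hγpos h1 h2
      exact ae_mu_iff.2 (Filter.Eventually.of_forall fun x hx => this x (Ioo_subset_Icc_self hx))
    -- The Wronskian at `0` is `P(0) Ψ(0)`. If `P(0) = 0`, then `Φ` has zero Cauchy data; if `Ψ(0) =
    -- 0`, then `Q(0) Φ - P(0) Ψ` has. Either contradicts independence.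
    rw [hΦ0, zero_mul, sub_zero, mul_eq_zero] at hW
    have hP0 : P 0 ≠ 0 := fun hP0 =>
      one_ne_zero (hdep 1 0 (by simp [hΦ0]) (by simp [hP0])).1
    have hΨ0 := hW.resolve_left hP0
    have := hdep (Q 0) (-P 0) (by simp [hΦ0, hΨ0]) (by ring)
    exact hP0 (neg_eq_zero.1 this.2)
  · have h1 := (hΦ.wronskian hΨ).eq_add_integral hx
    have e : ∀ x, Φ x * (lam * Ψ x) - lam * Φ x * Ψ x = 0 := fun x => by ring
    simp_rw [e] at h1
    simpa using h1

theorem IsPrim.integrable_mul {F v d : ℝ → ℝ} (hF : MemLp F 2 mu) (hv : IsPrim v d) :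
    Integrable (fun x => F x * v x) mu :=
  memLp_one_iff_integrable.1 (hv.memLp.mul (p := 2) (q := 2) hF)

theorem exists_solution_of_moments {γ γ₀ Φ P Ψ Q F : ℝ → ℝ} {lam : ℝ} (hγ₀ : MemLp γ₀ ⊤ mu)
    (hγpos : ∃ c : ℝ, 0 < c ∧ ∀ᵐ x ∂mu, c ≤ γ x) (hF : MemLp F 2 mu)
    (hΦ : IsSol γ γ₀ (fun x => lam * Φ x) Φ P) (hΦ0 : Φ 0 = 0) (hΦπ : Φ Real.pi = 0)
    (hΨ : IsSol γ γ₀ (fun x => lam * Ψ x) Ψ Q)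
    (hind : ∀ a b : ℝ, (∀ᵐ x ∂mu, a * Φ x + b * Ψ x = 0) → a = 0 ∧ b = 0)
    {ω : Set ℝ} (hω : IsOpen ω) (hωsub : ω ⊆ Ioo 0 Real.pi)
    (hnull : volume (pointComponents ω) = 0) (hF0 : ∀ᵐ x ∂(volume.restrict ω), F x = 0)
    (hM : ∀ C ∈ components ω, ∫ x in C, F x * Φ x = 0 ∧
      (¬ (C ∩ {0, Real.pi}).Nonempty → ∫ x in C, F x * Ψ x = 0)) :
    ∃ u ∈ domL γ γ₀, HasL γ γ₀ u (fun x => lam * u x + F x) ∧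
      ∀ᵐ x ∂(volume.restrict ω), u x = 0 := by
  obtain ⟨W, hW, hWr⟩ := exists_wronskian_eq hγ₀ hγpos hΦ hΦ0 hΨ hind
  have hFΦ : Integrable (fun x => F x * Φ x) mu := by
    obtain ⟨_, -, h, -⟩ := hΦ
    exact h.integrable_mul hF
  have hFΨ : Integrable (fun x => F x * Ψ x) mu := by
    obtain ⟨_, -, h, -⟩ := hΨ
    exact h.integrable_mul hF
  set m := ∫ t in connectedComponentIn (complClosure ω) 0, F t * Ψ t with hm
  -- The coefficient `W⁻¹ m` of `Φ` cancels `-W⁻¹ Φ B` on `ω`, where `B = m`; it is harmless at `0`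
  -- and `π` because `Φ` vanishes there.
  have hsol := hΦ.variation hΨ (isPrim_integral hFΦ) (isPrim_integral hFΨ) hW hWr (W⁻¹ * m)
  set u := fun x => W⁻¹ * (Ψ x * (∫ t in (0 : ℝ)..x, F t * Φ t) -
    Φ x * ∫ t in (0 : ℝ)..x, F t * Ψ t) + W⁻¹ * m * Φ x with hu
  have hzero : ∀ {v : ℝ → ℝ}, ∀ᵐ x ∂(volume.restrict ω), F x * v x = 0 := fun {v} => by
    filter_upwards [hF0] with x hx
    rw [hx, zero_mul]
  have hu0 : u 0 = 0 := by simp [hu, hΦ0]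
  have huπ : u Real.pi = 0 := by
    simp [hu, hΦπ, integral_zero_pi_eq_zero hω hnull hFΦ hzero fun C hC => (hM C hC).1]
  have huω : ∀ x ∈ ω, u x = 0 := by
    intro x hx
    have h1 := integral_eq_component_zero hω hnull hFΦ hzero hx (hωsub hx)
      fun C hC _ => (hM C hC).1
    have h2 := integral_eq_component_zero hω hnull hFΨ hzero hx (hωsub hx)
      fun C hC => (hM C hC).2
    have h3 : ∫ t in connectedComponentIn (complClosure ω) 0, F t * Φ t = 0 := by
      by_cases h0 : (0 : ℝ) ∈ complClosure ω
      · exact (hM _ ⟨0, h0, rfl⟩).1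
      · simp [connectedComponentIn_eq_empty h0]
    simp only [hu, h1, h2, h3]
    ring
  have hL : HasL γ γ₀ u (fun x => lam * u x + F x) := hsol.hasL
  obtain ⟨g, hg, hug, -⟩ := hsol
  exact ⟨u, ⟨hug.memH10 hg hu0 huπ, _, (hug.memLp.const_mul lam).add hF, hL⟩, hL,
    (ae_restrict_iff' hω.measurableSet).2 (Filter.Eventually.of_forall huω)⟩

end SturmLiouville

theorem mainTheorem5
    -- the coefficients: bounded, with `γ` bounded below by a positive constant
    (γ γ₀ : ℝ → ℝ)
    (hγ : MemLp γ ⊤ SturmLiouville.mu) (hγ₀ : MemLp γ₀ ⊤ SturmLiouville.mu)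
    (hγpos : ∃ c : ℝ, 0 < c ∧ ∀ᵐ x ∂SturmLiouville.mu, c ≤ γ x)
    (F : ℝ → ℝ) (hF : MemLp F 2 SturmLiouville.mu)
    (ω : Set ℝ) (hω : IsOpen ω) (hωne : ω.Nonempty) (hωsub : ω ⊆ Ioo 0 Real.pi)
    (lam : ℝ) (hlam : lam ∈ SturmLiouville.eigenvalues γ γ₀)
    (φ : ℝ → ℝ) (hφ : SturmLiouville.IsNormalizedEigenfunction γ γ₀ lam φ)
    (ψ : ℝ → ℝ) (hψ : SturmLiouville.IsSecondSolution γ γ₀ lam φ ψ) :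
    -- necessity, for every `ω`
    ((∃ u ∈ SturmLiouville.domL γ γ₀,
        SturmLiouville.HasL γ γ₀ u (fun x => lam * u x + F x) ∧
        ∀ᵐ x ∂(volume.restrict ω), u x = 0) →
      (∀ᵐ x ∂(volume.restrict ω), F x = 0) ∧ SturmLiouville.momentFamily φ ψ F ω = 0) ∧
    -- equivalence, if the union of the one-point components is a null set
    (volume (SturmLiouville.pointComponents ω) = 0 →
      ((∃ u ∈ SturmLiouville.domL γ γ₀,
          SturmLiouville.HasL γ γ₀ u (fun x => lam * u x + F x) ∧
          ∀ᵐ x ∂(volume.restrict ω), u x = 0) ↔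
        (∀ᵐ x ∂(volume.restrict ω), F x = 0) ∧ SturmLiouville.momentFamily φ ψ F ω = 0)) := by
  obtain ⟨Φ, P, hφΦ, hΦ, hΦ0, hΦπ⟩ :=
    -- The eigenfunction is the case of zero source, which also yields its boundary values.
    SturmLiouville.exists_isSol_of_mem_domL (F := fun _ => 0) (lam := lam)
      hγ hγ₀ MemLp.zero' hφ.1 (by simpa using hφ.2.1)
  simp only [add_zero] at hΦ
  have hψ2 : MemLp ψ 2 SturmLiouville.mu := hψ.1.1
  obtain ⟨Ψ, Q, hψΨ, hΨ'⟩ := hψ.2.1.exists_isSol hγ hγ₀ hψ2 (hψ2.const_mul lam)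
  have hΨ : SturmLiouville.IsSol γ γ₀ (fun x => lam * Ψ x) Ψ Q := hΨ'.congr <| by
    filter_upwards [hψΨ] with x hx
    rw [hx]
  have hmom : SturmLiouville.momentFamily φ ψ F ω = 0 ↔ ∀ C ∈ SturmLiouville.components ω,
      ∫ x in C, F x * Φ x = 0 ∧
        (¬ (C ∩ {0, Real.pi}).Nonempty → ∫ x in C, F x * Ψ x = 0) := by
    rw [SturmLiouville.momentFamily_eq_zero_iff]
    refine forall₂_congr fun C hC => ?_
    have hCI := (SturmLiouville.subset_complClosure_of_mem_components hC).trans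
      (SturmLiouville.complClosure_subset ω)
    rw [SturmLiouville.setIntegral_mul_congr hφΦ hCI, SturmLiouville.setIntegral_mul_congr hψΨ hCI]
  have hnec : (∃ u ∈ SturmLiouville.domL γ γ₀,
      SturmLiouville.HasL γ γ₀ u (fun x => lam * u x + F x) ∧
      ∀ᵐ x ∂(volume.restrict ω), u x = 0) →
      (∀ᵐ x ∂(volume.restrict ω), F x = 0) ∧ SturmLiouville.momentFamily φ ψ F ω = 0 := by
    rintro ⟨u, hu, hL, hu0⟩
    obtain ⟨U, R, huU, hU, hU0, hUπ⟩ :=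
      SturmLiouville.exists_isSol_of_mem_domL hγ hγ₀ hF hu hL
    obtain ⟨hz, hF0⟩ := hU.vanish_on hω hωsub <| by
      filter_upwards [hu0, SturmLiouville.ae_restrict_of_ae_mu
        (hωsub.trans Ioo_subset_Icc_self) huU] with x h1 h2
      rw [← h2, h1]
    exact ⟨hF0, hmom.2 fun C hC => hU.moments hU0 hUπ hΦ hΦ0 hΦπ hΨ hz hC⟩
  refine ⟨hnec, fun hnull => ⟨hnec, fun ⟨hF0, hM⟩ => ?_⟩⟩
  refine SturmLiouville.exists_solution_of_moments hγ₀ hγpos hF hΦ hΦ0 hΦπ hΨ ?_ hω hωsub hnull hF0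
    (hmom.1 hM)
  intro a b hab
  refine hψ.2.2 a b ?_
  filter_upwards [hab, hφΦ, hψΨ] with x h1 h2 h3
  rw [h2, h3, h1]
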